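/- Let $A\in M_{n\times n}(\mathbb{C})$ be invertible, let $\alpha>0$, $0<p<1$, and $r=\frac{-p}{p-1}$ (so $r>0$ and $\frac1p-\frac1r=1$). For $X\in M_{n\times n}(\mathbb{C})$ write $|X|=(X^*X)^{1/2}$. Then, for every norm $|||\cdot|||$ on $M_{n\times n}(\mathbb{C})$ that is unitarily invariant (that is, $|||UXV|||=|||X|||$ for all $X$ and all unitary $U,V$), $$\big|\big|\big|\,|A|^{\alpha}\,\big|\big|\big| = \max_{A=BC}\Big\{\big|\big|\big|\,|B|^{\alpha p}\,\big|\big|\big|^{1/p}\;\big|\big|\big|\,|C|^{-\alpha r}\,\big|\big|\big|^{-1/r}\Big\} = \max_{A=BC}\Big\{\tfrac1p\,\big|\big|\big|\,|B|^{\alpha p}\,\big|\big|\big| - \tfrac1r\,\big|\big|\big|\,|C|^{-\alpha r}\,\big|\big|\big|\Big\},$$ where both maxima are attained and run over all pairs $B,C\in M_{n\times n}(\mathbb{C})$ with $A=BC$ (such $B$ and $C$ are automatically invertible). -/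

import Mathlib

open scoped Matrix MatrixOrder

/-- A norm `N` on `M_n(ℂ)` (a seminorm that vanishes only at `0`) is unitarily invariant if
`N (U X V) = N X` for all matrices `X` and all unitary matrices `U`, `V`. -/
structure IsUnitarilyInvariantNorm {n : ℕ} (N : Seminorm ℂ (Matrix (Fin n) (Fin n) ℂ)) :
    Prop where
  eq_zero_of_map_eq_zero : ∀ X : Matrix (Fin n) (Fin n) ℂ, N X = 0 → X = 0
  map_unitary_mul_mul : ∀ U ∈ Matrix.unitaryGroup (Fin n) ℂ,
    ∀ V ∈ Matrix.unitaryGroup (Fin n) ℂ, ∀ X : Matrix (Fin n) (Fin n) ℂ, N (U * X * V) = N X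

/-- The real power `|X| ^ s` of the absolute value `|X| = (Xᴴ X) ^ (1/2)` of a complex square
matrix, both formed by the continuous functional calculus. -/
noncomputable def matrixAbsPow {n : ℕ} (X : Matrix (Fin n) (Fin n) ℂ) (s : ℝ) :
    Matrix (Fin n) (Fin n) ℂ :=
  CFC.rpow (CFC.abs X) s

open scoped ComplexOrder


/-! Everything rests on one Hölder-type inequality for `B = A C⁻¹`: `N(|B|^(αp)) ≤ N(|A|^α)^p *
N(|C|^(-αr))^(1-p)`. Since `(1-p)/p = 1/r`, solving it for `N(|A|^α)` bounds the products, and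
weighted AM-GM bounds the differences. Splitting the singular values as `a = a^(1/p) * a^(-1/r)`
gives equality in both.

For the inequality, unitary invariance replaces each matrix by its singular values: `a`, `b`, `d`
for `A`, `B`, `C⁻¹`. Hahn-Banach, sign changes and rearrangement give a decreasing nonnegative
functional `c` norming `b^(αp)` (`exists_antitone_dual`). Horn's inequality
(`prod_singularValues_mul_le`) says that `b` is weakly log-majorized by `a d`, so `∑ c b^(αp) ≤ ∑ c
(a d)^(αp)`. Scalar Hölder splits the right side, and duality bounds each factor by a norm. -/

/-- The complex diagonal matrix with real entries `x`. -/
def realDiagonal {m : Type*} [DecidableEq m] (x : m → ℝ) : Matrix m m ℂ :=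
  Matrix.diagonal fun i => (x i : ℂ)

/-! ### Functional calculus of unitarily diagonalized matrices. -/

section realDiagonal

variable {m : Type*} [DecidableEq m]

lemma realDiagonal_mul [Fintype m] (x y : m → ℝ) :
    realDiagonal x * realDiagonal y = realDiagonal fun i => x i * y i := by
  simp [realDiagonal, Matrix.diagonal_mul_diagonal]

lemma realDiagonal_eq_one {x : m → ℝ} (hx : ∀ i, x i = 1) : realDiagonal x = 1 := by
  simp [realDiagonal, hx]

lemma conjTranspose_realDiagonal (x : m → ℝ) : (realDiagonal x)ᴴ = realDiagonal x := by
  simp only [realDiagonal, Matrix.diagonal_conjTranspose]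
  congr 1
  ext i
  simp

lemma posSemidef_realDiagonal {x : m → ℝ} (hx : ∀ i, 0 ≤ x i) :
    (realDiagonal x).PosSemidef :=
  Matrix.PosSemidef.diagonal fun i => by simpa using hx i

lemma aeval_conj_realDiagonal [Fintype m] {U : Matrix m m ℂ} (hU : U ∈ Matrix.unitaryGroup m ℂ)
    (x : m → ℝ) (q : Polynomial ℝ) :
    Polynomial.aeval (U * realDiagonal x * Uᴴ) q =
      U * realDiagonal (fun i => q.eval (x i)) * Uᴴ := by
  have h1 : Uᴴ * U = 1 := Matrix.mem_unitaryGroup_iff'.1 hU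
  have h2 : U * Uᴴ = 1 := Matrix.mem_unitaryGroup_iff.1 hU
  induction q using Polynomial.induction_on' with
  | add p q hp hq =>
    have : realDiagonal (fun i => (p + q).eval (x i)) =
        realDiagonal (fun i => p.eval (x i)) + realDiagonal fun i => q.eval (x i) := by
      simp [realDiagonal, Matrix.diagonal_add]
    rw [map_add, hp, hq, this, mul_add, add_mul]
  | monomial k a =>
    have hk : ∀ k : ℕ, (U * realDiagonal x * Uᴴ) ^ k =
        U * realDiagonal (fun i => x i ^ k) * Uᴴ := by
      intro k
      induction k with
      | zero => simp [realDiagonal_eq_one, h2]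
      | succ k ih =>
        calc _ = U * realDiagonal (fun i => x i ^ k) * (Uᴴ * U) * realDiagonal x * Uᴴ := by
              rw [pow_succ, ih]; simp only [Matrix.mul_assoc]
          _ = _ := by
              rw [h1, Matrix.mul_one, Matrix.mul_assoc U, realDiagonal_mul]
              simp only [pow_succ]
    have : realDiagonal (fun i => (Polynomial.monomial k a).eval (x i)) =
        a • realDiagonal (fun i => x i ^ k) := by
      ext i j
      by_cases h : i = j
      · subst h; simp [realDiagonal]
      · simp [realDiagonal, h]
    rw [Polynomial.aeval_monomial, hk, this, ← Algebra.smul_def, Matrix.mul_smul, Matrix.smul_mul]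

/-- The spectrum is finite, so a Lagrange interpolant can replace `f`, which need not be continuous.
-/
lemma cfc_conj_realDiagonal [Fintype m] {U : Matrix m m ℂ} (hU : U ∈ Matrix.unitaryGroup m ℂ)
    (x : m → ℝ) (f : ℝ → ℝ) :
    cfc f (U * realDiagonal x * Uᴴ) = U * realDiagonal (fun i => f (x i)) * Uᴴ := by
  have hH : (U * realDiagonal x * Uᴴ).IsHermitian :=
    Matrix.isHermitian_mul_mul_conjTranspose U (conjTranspose_realDiagonal x)
  have hfin := Matrix.finite_real_spectrum (A := U * realDiagonal x * Uᴴ)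
  classical
  -- Including the values of `x` among the nodes avoids identifying them with the spectrum.
  set s : Finset ℝ := hfin.toFinset ∪ Finset.univ.image x
  have hs : ∀ t ∈ s, (Lagrange.interpolate s id f).eval t = f t := fun t ht =>
    Lagrange.eval_interpolate_at_node f (Set.injOn_id _) ht
  rw [cfc_congr (g := (Lagrange.interpolate s id f).eval) fun t ht =>
      (hs t (Finset.mem_union_left _ (hfin.mem_toFinset.2 ht))).symm,
    cfc_polynomial _ _ hH.isSelfAdjoint, aeval_conj_realDiagonal hU]
  congr 3
  ext i
  exact hs _ (Finset.mem_union_right _ (Finset.mem_image_of_mem _ (Finset.mem_univ i)))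

end realDiagonal

/-! ### Singular value decomposition. -/

lemma matrixAbsPow_svd {n : ℕ} {U V : Matrix (Fin n) (Fin n) ℂ}
    (hU : U ∈ Matrix.unitaryGroup (Fin n) ℂ) (hV : V ∈ Matrix.unitaryGroup (Fin n) ℂ)
    {x : Fin n → ℝ} (hx : ∀ i, 0 < x i) (s : ℝ) :
    matrixAbsPow (U * realDiagonal x * V) s = Vᴴ * realDiagonal (fun i => x i ^ s) * V := by
  have h1 : Uᴴ * U = 1 := Matrix.mem_unitaryGroup_iff'.1 hU
  have h2 : V * Vᴴ = 1 := Matrix.mem_unitaryGroup_iff.1 hV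
  have hV' : Vᴴ ∈ Matrix.unitaryGroup (Fin n) ℂ := Unitary.star_mem hV
  have hpos : 0 ≤ Vᴴ * realDiagonal x * V :=
    ((posSemidef_realDiagonal fun i => (hx i).le).conjTranspose_mul_mul_same V).nonneg
  have habs : CFC.abs (U * realDiagonal x * V) = Vᴴ * realDiagonal x * V := by
    refine CFC.sqrt_unique ?_ hpos
    rw [Matrix.star_eq_conjTranspose, Matrix.conjTranspose_mul, Matrix.conjTranspose_mul,
      conjTranspose_realDiagonal]
    calc _ = Vᴴ * realDiagonal x * (V * Vᴴ) * realDiagonal x * V := by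
          simp only [Matrix.mul_assoc]
      _ = Vᴴ * realDiagonal x * (Uᴴ * U) * realDiagonal x * V := by rw [h1, h2]
      _ = _ := by simp only [Matrix.mul_assoc]
  have key := cfc_conj_realDiagonal hV' x (fun t => t ^ s)
  rw [Matrix.conjTranspose_conjTranspose] at key
  rw [matrixAbsPow, habs, ← key]
  exact CFC.rpow_eq_cfc_real hpos

/-- Diagonalize `Xᴴ X` by `P`, eigenvalues sorted decreasingly; then `X P` times the inverse square
roots of the eigenvalues is unitary. -/
lemma exists_svd {n : ℕ} {X : Matrix (Fin n) (Fin n) ℂ} (hX : IsUnit X) :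
    ∃ U ∈ Matrix.unitaryGroup (Fin n) ℂ, ∃ V ∈ Matrix.unitaryGroup (Fin n) ℂ,
      ∃ x : Fin n → ℝ, (∀ i, 0 < x i) ∧ Antitone x ∧ X = U * realDiagonal x * V := by
  have hP : (Xᴴ * X).PosDef := Matrix.PosDef.conjTranspose_mul_self X
    (Matrix.mulVec_injective_iff_isUnit.2 hX)
  have hpos := hP.eigenvalues_pos
  set W : Matrix (Fin n) (Fin n) ℂ := ↑hP.1.eigenvectorUnitary
  have hWu : W ∈ Matrix.unitaryGroup (Fin n) ℂ := hP.1.eigenvectorUnitary.2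
  have hspec : Xᴴ * X = W * realDiagonal hP.1.eigenvalues * Wᴴ := by
    have := hP.1.spectral_theorem
    rw [Unitary.conjStarAlgAut_apply] at this
    exact this
  set l := hP.1.eigenvalues
  have h1 : Wᴴ * W = 1 := Matrix.mem_unitaryGroup_iff'.1 hWu
  let σ : Equiv.Perm (Fin n) := Tuple.sort fun i => -l i
  have hσ : Antitone fun i => l (σ i) := fun i j hij =>
    neg_le_neg_iff.1 (Tuple.monotone_sort (fun i => -l i) hij)
  set P : Matrix (Fin n) (Fin n) ℂ := W.submatrix id σ
  have hPu1 : Pᴴ * P = 1 := by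
    have : Pᴴ * P = (Wᴴ * W).submatrix σ σ := by ext i j; simp [P, Matrix.mul_apply]
    rw [this, h1, Matrix.submatrix_one_equiv]
  have hPu : P ∈ Matrix.unitaryGroup (Fin n) ℂ := Matrix.mem_unitaryGroup_iff'.2 hPu1
  have hPu2 : P * Pᴴ = 1 := Matrix.mem_unitaryGroup_iff.1 hPu
  have hdiag : Pᴴ * (Xᴴ * X) * P = realDiagonal fun i => l (σ i) := by
    have : Wᴴ * (Xᴴ * X) * W = realDiagonal l := by
      rw [hspec]
      calc _ = (Wᴴ * W) * realDiagonal l * (Wᴴ * W) := by simp only [Matrix.mul_assoc]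
        _ = _ := by rw [h1, Matrix.one_mul, Matrix.mul_one]
    have h3 : Pᴴ * (Xᴴ * X) * P = (Wᴴ * (Xᴴ * X) * W).submatrix σ σ := by
      ext i j; simp [P, Matrix.mul_apply]
    rw [h3, this]
    simp [realDiagonal, Matrix.submatrix_diagonal_equiv, Function.comp_def]
  have hx : ∀ i, 0 < Real.sqrt (l (σ i)) := fun i => Real.sqrt_pos.2 (hpos _)
  refine ⟨X * P * realDiagonal fun i => (Real.sqrt (l (σ i)))⁻¹, ?_, Pᴴ, Unitary.star_mem hPu,
    fun i => Real.sqrt (l (σ i)), hx, fun i j hij => Real.sqrt_le_sqrt (hσ hij), ?_⟩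
  · rw [Matrix.mem_unitaryGroup_iff', Matrix.star_eq_conjTranspose, Matrix.conjTranspose_mul,
      Matrix.conjTranspose_mul, conjTranspose_realDiagonal]
    calc _ = realDiagonal (fun i => (Real.sqrt (l (σ i)))⁻¹) * (Pᴴ * (Xᴴ * X) * P) *
          realDiagonal (fun i => (Real.sqrt (l (σ i)))⁻¹) := by simp only [Matrix.mul_assoc]
      _ = 1 := by
        rw [hdiag, realDiagonal_mul, realDiagonal_mul]
        refine realDiagonal_eq_one fun i => ?_
        have := hx i
        field_simp
        rw [Real.sq_sqrt (hpos (σ i)).le]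
  · calc X = X * (P * Pᴴ) := by rw [hPu2, Matrix.mul_one]
      _ = X * P * (realDiagonal (fun i => (Real.sqrt (l (σ i)))⁻¹) *
          realDiagonal fun i => Real.sqrt (l (σ i))) * Pᴴ := by
        rw [realDiagonal_mul, realDiagonal_eq_one fun i => inv_mul_cancel₀ (hx i).ne']
        simp only [Matrix.mul_assoc, Matrix.one_mul]
      _ = _ := by simp only [Matrix.mul_assoc]

/-! ### The symmetric gauge function of the norm and its dual. -/

namespace IsUnitarilyInvariantNorm

variable {n : ℕ} {N : Seminorm ℂ (Matrix (Fin n) (Fin n) ℂ)}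

lemma map_matrixAbsPow (hN : IsUnitarilyInvariantNorm N) {U V : Matrix (Fin n) (Fin n) ℂ}
    (hU : U ∈ Matrix.unitaryGroup (Fin n) ℂ) (hV : V ∈ Matrix.unitaryGroup (Fin n) ℂ)
    {x : Fin n → ℝ} (hx : ∀ i, 0 < x i) (s : ℝ) :
    N (matrixAbsPow (U * realDiagonal x * V) s) = N (realDiagonal fun i => x i ^ s) := by
  rw [matrixAbsPow_svd hU hV hx]
  exact hN.map_unitary_mul_mul _ (Unitary.star_mem hV) _ hV _

lemma map_realDiagonal_comp_perm (hN : IsUnitarilyInvariantNorm N) (σ : Equiv.Perm (Fin n))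
    (x : Fin n → ℝ) : N (realDiagonal fun i => x (σ i)) = N (realDiagonal x) := by
  have hσ : σ.permMatrix ℂ ∈ Matrix.unitaryGroup (Fin n) ℂ := by
    rw [Matrix.mem_unitaryGroup_iff, Matrix.star_eq_conjTranspose,
      Matrix.conjTranspose_permMatrix, ← Matrix.permMatrix_mul]
    simp
  rw [← hN.map_unitary_mul_mul _ hσ _ (Unitary.star_mem hσ) (realDiagonal x)]
  congr 1
  rw [Matrix.star_eq_conjTranspose, Matrix.conjTranspose_permMatrix, PEquiv.toMatrix_toPEquiv_mul,
    PEquiv.mul_toMatrix_toPEquiv, Matrix.submatrix_submatrix]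
  exact (Matrix.submatrix_diagonal_equiv (fun i => (x i : ℂ)) σ).symm

lemma map_realDiagonal_sign (hN : IsUnitarilyInvariantNorm N) {e : Fin n → ℝ}
    (he : ∀ i, e i * e i = 1) (x : Fin n → ℝ) :
    N (realDiagonal fun i => e i * x i) = N (realDiagonal x) := by
  have h : realDiagonal e ∈ Matrix.unitaryGroup (Fin n) ℂ := by
    rw [Matrix.mem_unitaryGroup_iff, Matrix.star_eq_conjTranspose, conjTranspose_realDiagonal,
      realDiagonal_mul, realDiagonal_eq_one he]
  have := hN.map_unitary_mul_mul _ h 1 (one_mem _) (realDiagonal x)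
  rwa [Matrix.mul_one, realDiagonal_mul] at this

/-- A decreasing nonnegative vector is normed by a decreasing nonnegative functional in the dual
unit ball of the gauge function `x ↦ N (diag x)`. -/
lemma exists_antitone_dual (hN : IsUnitarilyInvariantNorm N) {x : Fin n → ℝ}
    (hx0 : ∀ i, 0 ≤ x i) (hx : Antitone x) :
    ∃ c : Fin n → ℝ, (∀ i, 0 ≤ c i) ∧ Antitone c ∧ N (realDiagonal x) ≤ ∑ i, c i * x i ∧
      ∀ y : Fin n → ℝ, ∑ i, c i * y i ≤ N (realDiagonal y) := by
  have hsmul : ∀ (t : ℝ) (y : Fin n → ℝ),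
      realDiagonal (t • y) = (t : ℂ) • realDiagonal y := fun t y => by
    ext i j
    by_cases h : i = j
    · subst h; simp [realDiagonal]
    · simp [realDiagonal, h]
  have hadd : ∀ y z : Fin n → ℝ, realDiagonal (y + z) = realDiagonal y + realDiagonal z :=
    fun y z => by simp [realDiagonal, Matrix.diagonal_add]
  -- Hahn-Banach: extend `t x ↦ t N(diag x)` from the line through `x`.
  obtain ⟨g, hg1, hg2⟩ : ∃ g : (Fin n → ℝ) →ₗ[ℝ] ℝ, N (realDiagonal x) ≤ g x ∧
      ∀ y, g y ≤ N (realDiagonal y) := by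
    rcases eq_or_ne x 0 with rfl | hx
    · exact ⟨0, by simp [realDiagonal], fun y => apply_nonneg N _⟩
    obtain ⟨g, hg1, hg2⟩ := exists_extension_of_le_sublinear
      (LinearPMap.mkSpanSingleton (K := ℝ) x (N (realDiagonal x)) hx)
      (fun y => N (realDiagonal y))
      (fun c hc y => by rw [hsmul, map_smul_eq_mul]; simp [abs_of_pos hc])
      (fun y z => by rw [hadd]; exact map_add_le_add N _ _)
      (by
        rintro ⟨y, hy⟩
        obtain ⟨t, rfl⟩ := Submodule.mem_span_singleton.1 hy
        refine (LinearPMap.mkSpanSingleton'_apply _ _ _ _ _).trans_le ?_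
        rw [hsmul, map_smul_eq_mul]
        simp only [smul_eq_mul, Complex.norm_real, Real.norm_eq_abs]
        exact mul_le_mul_of_nonneg_right (le_abs_self t) (apply_nonneg N _))
    refine ⟨g, ?_, hg2⟩
    exact ((hg1 ⟨x, Submodule.mem_span_singleton_self x⟩).trans
      (LinearPMap.mkSpanSingleton'_apply_self _ _ _ _)).ge
  let c : Fin n → ℝ := fun i => g (Pi.single i 1)
  have hgc : ∀ y, g y = ∑ i, c i * y i := fun y => by
    conv_lhs => rw [pi_eq_sum_univ' y]
    simp [c, mul_comm]
  -- Pass to the decreasing rearrangement of `|c|`: this can only increase the pairing with the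
  -- decreasing `x`, and the dual bound survives by sign and permutation invariance.
  let σ : Equiv.Perm (Fin n) := Tuple.sort fun i => -|c i|
  have hσ : Antitone fun i => |c (σ i)| := fun i j hij =>
    neg_le_neg_iff.1 (Tuple.monotone_sort (fun i => -|c i|) hij)
  refine ⟨fun i => |c (σ i)|, fun i => abs_nonneg _, hσ, ?_, fun y => ?_⟩
  · calc _ ≤ ∑ i, c i * x i := hg1.trans_eq (hgc x)
      _ ≤ ∑ i, |c i| * x i := Finset.sum_le_sum fun i _ =>
        mul_le_mul_of_nonneg_right (le_abs_self _) (hx0 i)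
      _ ≤ _ := by
        have := (hσ.monovary hx).sum_comp_perm_mul_le_sum_mul (σ := σ⁻¹)
        simpa using this
  · let e : Fin n → ℝ := fun i => if 0 ≤ c i then 1 else -1
    have he : ∀ i, e i * e i = 1 := fun i => by by_cases h : 0 ≤ c i <;> simp [e, h]
    have hec : ∀ i, |c i| = c i * e i := fun i => by
      by_cases h : 0 ≤ c i
      · simp [e, h, abs_of_nonneg h]
      · simp [e, h, abs_of_neg (not_le.1 h)]
    have h := hg2 fun i => e i * y (σ⁻¹ i)
    rw [hN.map_realDiagonal_sign he, hN.map_realDiagonal_comp_perm, hgc] at h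
    refine le_trans (le_of_eq ?_) h
    rw [← Equiv.sum_comp σ fun i => c i * (e i * y (σ⁻¹ i))]
    simp [hec, mul_assoc]

end IsUnitarilyInvariantNorm


/-! ### Determinant inequalities for positive matrices. -/

lemma one_add_realDiagonal {m : Type*} [DecidableEq m] (x : m → ℝ) :
    1 + realDiagonal x = realDiagonal fun i => 1 + x i := by
  ext i j
  by_cases h : i = j
  · subst h; simp [realDiagonal]
  · simp [realDiagonal, h]

section det

variable {m : Type*} [DecidableEq m] [Fintype m]

lemma Matrix.PosSemidef.one_le_det_one_add {Q : Matrix m m ℂ} (hQ : Q.PosSemidef) :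
    1 ≤ (1 + Q).det := by
  have hW := hQ.1.eigenvectorUnitary.2
  set W : Matrix m m ℂ := ↑hQ.1.eigenvectorUnitary
  have h2 : W * Wᴴ = 1 := Matrix.mem_unitaryGroup_iff.1 hW
  have hspec : Q = W * realDiagonal hQ.1.eigenvalues * Wᴴ := by
    have := hQ.1.spectral_theorem
    rw [Unitary.conjStarAlgAut_apply] at this
    exact this
  have hnn := hQ.eigenvalues_nonneg
  set l := hQ.1.eigenvalues
  have h : 1 + Q = W * realDiagonal (fun i => 1 + l i) * Wᴴ := by
    rw [← one_add_realDiagonal, mul_add, add_mul, ← hspec, Matrix.mul_one, h2]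
  have hdet : (1 + Q).det = ((∏ i, (1 + l i) : ℝ) : ℂ) := by
    rw [h, Matrix.det_mul, Matrix.det_mul, mul_right_comm, ← Matrix.det_mul, h2, Matrix.det_one,
      one_mul, realDiagonal, Matrix.det_diagonal]
    push_cast
    rfl
  rw [hdet]
  have : 1 ≤ ∏ i, (1 + l i) :=
    Finset.prod_induction _ (1 ≤ ·) (fun _ _ => one_le_mul_of_one_le_of_one_le) le_rfl
      fun i _ => by linarith [hnn i]
  exact_mod_cast this

lemma Matrix.PosDef.exists_sqrt {A : Matrix m m ℂ} (hA : A.PosDef) :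
    ∃ R : Matrix m m ℂ, Rᴴ = R ∧ R * R = A ∧ IsUnit R.det := by
  have h := CFC.sqrt_mul_sqrt_self A hA.posSemidef.nonneg
  refine ⟨CFC.sqrt A, (Matrix.nonneg_iff_posSemidef.1 (CFC.sqrt_nonneg A)).1, h, ?_⟩
  rw [isUnit_iff_ne_zero]
  intro h0
  have := hA.det_pos.ne'
  rw [← h, Matrix.det_mul, h0, mul_zero] at this
  exact this rfl

/-- With `R = A^(1/2)`, `B = R (1 + Q) R` for a positive semidefinite `Q`, and `det (1 + Q) ≥ 1`. -/
lemma Matrix.PosDef.det_le_det {A B : Matrix m m ℂ} (hA : A.PosDef)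
    (hAB : (B - A).PosSemidef) : A.det ≤ B.det := by
  obtain ⟨R, hR, hRA, hu⟩ := hA.exists_sqrt
  have hQ : (R⁻¹ * (B - A) * R⁻¹).PosSemidef := by
    have := hAB.conjTranspose_mul_mul_same R⁻¹
    rwa [Matrix.conjTranspose_nonsing_inv, hR] at this
  have hB : B = R * (1 + R⁻¹ * (B - A) * R⁻¹) * R := by
    rw [mul_add, add_mul, Matrix.mul_one, hRA]
    calc B = A + (B - A) := by abel
      _ = A + (R * R⁻¹) * (B - A) * (R⁻¹ * R) := by
        rw [Matrix.mul_nonsing_inv _ hu, Matrix.nonsing_inv_mul _ hu, Matrix.one_mul,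
          Matrix.mul_one]
      _ = _ := by simp only [Matrix.mul_assoc]
  have hdet : B.det = A.det * (1 + R⁻¹ * (B - A) * R⁻¹).det := by
    conv_lhs => rw [hB]
    rw [Matrix.det_mul, Matrix.det_mul, ← hRA, Matrix.det_mul]
    ring
  rw [hdet]
  exact le_mul_of_one_le_right hA.det_pos.le hQ.one_le_det_one_add

end det

lemma posSemidef_one_sub_mul_conjTranspose {m κ : Type*} [Fintype m] [DecidableEq m] [Fintype κ]
    [DecidableEq κ] {V : Matrix m κ ℂ} (hV : Vᴴ * V = 1) : (1 - V * Vᴴ).PosSemidef := by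
  have h : (1 - V * Vᴴ)ᴴ * (1 - V * Vᴴ) = 1 - V * Vᴴ := by
    have : V * Vᴴ * (V * Vᴴ) = V * Vᴴ := by
      rw [Matrix.mul_assoc, ← Matrix.mul_assoc Vᴴ, hV, Matrix.one_mul]
    rw [Matrix.conjTranspose_sub, Matrix.conjTranspose_one, Matrix.conjTranspose_mul,
      Matrix.conjTranspose_conjTranspose, Matrix.mul_sub, Matrix.sub_mul, Matrix.sub_mul, this]
    simp
  rw [← h]
  exact Matrix.posSemidef_conjTranspose_mul_self _

lemma posDef_realDiagonal {m : Type*} [Fintype m] [DecidableEq m] {x : m → ℝ}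
    (hx : ∀ i, 0 < x i) : (realDiagonal x).PosDef :=
  Matrix.PosDef.diagonal fun i => by simpa using hx i

lemma mulVec_injective_of_conjTranspose_mul_eq_one {m κ : Type*} [Fintype m] [Fintype κ]
    [DecidableEq κ] {V : Matrix m κ ℂ} (hV : Vᴴ * V = 1) : Function.Injective V.mulVec :=
  fun x y hxy => by
    have := congrArg (Vᴴ *ᵥ ·) hxy
    simpa [Matrix.mulVec_mulVec, hV] using this

/-- The determinant of a `k`-dimensional compression of a positive diagonal matrix is at most the
product of its `k` largest entries. -/
lemma det_compression_le {n k : ℕ} (hk : k ≤ n) {l : Fin n → ℝ} (hl0 : ∀ i, 0 < l i)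
    (hl : Antitone l) {V : Matrix (Fin n) (Fin k) ℂ} (hV : Vᴴ * V = 1) :
    (Vᴴ * realDiagonal l * V).det ≤ ((∏ i : Fin k, l (Fin.castLE hk i) : ℝ) : ℂ) := by
  rcases k with _ | k
  · simp
  -- `t` is the smallest of the leading entries. The excess `δ` satisfies `l ≤ t (1 + δ)` and
  -- vanishes past them, so `∏ (1 + δ i)` over all indices sees only the leading ones.
  set t := l (Fin.castLE hk (Fin.last k))
  have ht0 : 0 < t := hl0 _
  set δ : Fin n → ℝ := fun i => max (l i / t - 1) 0
  have hδ0 : ∀ i, 0 ≤ δ i := fun i => le_max_right _ _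
  have hδl : ∀ i, l i ≤ t * (1 + δ i) := fun i => by
    have : l i / t - 1 ≤ δ i := le_max_left _ _
    have h2 : l i / t ≤ 1 + δ i := by linarith
    rw [div_le_iff₀ ht0] at h2
    linarith
  have hpd : (Vᴴ * realDiagonal l * V).PosDef :=
    (posDef_realDiagonal hl0).conjTranspose_mul_mul_same
      (mulVec_injective_of_conjTranspose_mul_eq_one hV)
  have h1 : (Vᴴ * realDiagonal l * V).det ≤ ((t : ℂ) • (1 + Vᴴ * realDiagonal δ * V)).det := by
    refine hpd.det_le_det ?_
    have : (t : ℂ) • (1 + Vᴴ * realDiagonal δ * V) - Vᴴ * realDiagonal l * V =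
        Vᴴ * realDiagonal (fun i => t * (1 + δ i) - l i) * V := by
      have h : realDiagonal (fun i => t * (1 + δ i) - l i) =
          (t : ℂ) • (1 + realDiagonal δ) - realDiagonal l := by
        ext i j
        by_cases hij : i = j
        · subst hij; simp [realDiagonal, mul_add]
        · simp [realDiagonal, hij]
      rw [h, Matrix.mul_sub, Matrix.sub_mul, Matrix.mul_smul, Matrix.smul_mul, Matrix.mul_add,
        Matrix.add_mul, Matrix.mul_one, hV]
    rw [this]
    exact (posSemidef_realDiagonal fun i => by linarith [hδl i]).conjTranspose_mul_mul_same V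
  set E : Matrix (Fin n) (Fin n) ℂ := realDiagonal fun i => Real.sqrt (δ i) with hE
  have hEH : Eᴴ = E := conjTranspose_realDiagonal _
  have hEE : E * E = realDiagonal δ := by
    rw [hE, realDiagonal_mul]
    simp only [Real.mul_self_sqrt (hδ0 _)]
  -- Sylvester's identity moves the determinant to size `n`, where `V Vᴴ ≤ 1` applies.
  have h2 : (1 + Vᴴ * realDiagonal δ * V).det = (1 + E * (V * Vᴴ) * E).det := by
    have e1 : Vᴴ * realDiagonal δ * V = (Vᴴ * E) * (E * V) := by
      rw [← hEE]; simp only [Matrix.mul_assoc]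
    have e2 : E * (V * Vᴴ) * E = (E * V) * (Vᴴ * E) := by simp only [Matrix.mul_assoc]
    rw [e1, e2, Matrix.det_one_add_mul_comm]
  have h3 : (1 + E * (V * Vᴴ) * E).det ≤ (realDiagonal fun i => 1 + δ i).det := by
    have hps : (E * (V * Vᴴ) * E).PosSemidef := by
      have := (Matrix.posSemidef_self_mul_conjTranspose V).conjTranspose_mul_mul_same E
      rwa [hEH] at this
    refine (Matrix.PosDef.one.add_posSemidef hps).det_le_det ?_
    have : (realDiagonal fun i => 1 + δ i) - (1 + E * (V * Vᴴ) * E) =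
        Eᴴ * (1 - V * Vᴴ) * E := by
      rw [hEH, Matrix.mul_sub, Matrix.sub_mul, Matrix.mul_one, hEE, ← one_add_realDiagonal]
      abel
    rw [this]
    exact (posSemidef_one_sub_mul_conjTranspose hV).conjTranspose_mul_mul_same E
  have h4 : (realDiagonal fun i => 1 + δ i).det =
      ((∏ i : Fin (k + 1), l (Fin.castLE hk i) / t : ℝ) : ℂ) := by
    have : ∏ i : Fin (k + 1), l (Fin.castLE hk i) / t = ∏ i, (1 + δ i) := by
      refine Fintype.prod_of_injective _ (Fin.castLE_injective hk) _ _ (fun i hi => ?_) fun i => ?_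
      · have hik : Fin.castLE hk (Fin.last k) ≤ i := by
          by_contra hlt
          refine hi ⟨⟨i, ?_⟩, rfl⟩
          have := Fin.lt_def.1 (not_le.1 hlt)
          simp at this
          omega
        have : l i / t ≤ 1 := (div_le_one ht0).2 (hl hik)
        simp only [δ]
        rw [max_eq_right (by linarith)]
        simp
      · have : 1 ≤ l (Fin.castLE hk i) / t := (one_le_div ht0).2 <| hl <| by
          simpa using Fin.le_last i
        simp only [δ]
        rw [max_eq_left (by linarith)]
        ring
    rw [this, realDiagonal, Matrix.det_diagonal]
    push_cast
    rfl
  have h5 : (t : ℂ) ^ (k + 1) * ((∏ i : Fin (k + 1), l (Fin.castLE hk i) / t : ℝ) : ℂ) =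
      ((∏ i : Fin (k + 1), l (Fin.castLE hk i) : ℝ) : ℂ) := by
    rw [← Complex.ofReal_pow, ← Complex.ofReal_mul, Finset.prod_div_distrib]
    simp only [Finset.prod_const, Finset.card_univ, Fintype.card_fin]
    rw [mul_div_cancel₀ _ (pow_ne_zero _ ht0.ne')]
  calc _ ≤ ((t : ℂ) • (1 + Vᴴ * realDiagonal δ * V)).det := h1
    _ = (t : ℂ) ^ (k + 1) * (1 + E * (V * Vᴴ) * E).det := by
      rw [Matrix.det_smul, h2, Fintype.card_fin]
    _ ≤ (t : ℂ) ^ (k + 1) * (realDiagonal fun i => 1 + δ i).det := by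
      refine mul_le_mul_of_nonneg_left h3 ?_
      exact_mod_cast (pow_pos ht0 (k + 1)).le
    _ = _ := by rw [h4, h5]

/-! ### Horn's inequality. -/

lemma conjTranspose_svd_mul_self {n : ℕ} {U V : Matrix (Fin n) (Fin n) ℂ}
    (hU : U ∈ Matrix.unitaryGroup (Fin n) ℂ) (x : Fin n → ℝ) :
    (U * realDiagonal x * V)ᴴ * (U * realDiagonal x * V) =
      Vᴴ * realDiagonal (fun i => x i ^ 2) * V := by
  have h1 : Uᴴ * U = 1 := Matrix.mem_unitaryGroup_iff'.1 hU
  rw [Matrix.conjTranspose_mul, Matrix.conjTranspose_mul, conjTranspose_realDiagonal]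
  calc _ = Vᴴ * (realDiagonal x * (Uᴴ * U) * realDiagonal x) * V := by
        simp only [Matrix.mul_assoc]
    _ = _ := by rw [h1, Matrix.mul_one, realDiagonal_mul]; simp only [sq]

lemma det_gram_svd_mul_le {n k : ℕ} (hk : k ≤ n) {U V : Matrix (Fin n) (Fin n) ℂ}
    (hU : U ∈ Matrix.unitaryGroup (Fin n) ℂ) (hV : V ∈ Matrix.unitaryGroup (Fin n) ℂ)
    {x : Fin n → ℝ} (hx0 : ∀ i, 0 < x i) (hx : Antitone x)
    {W : Matrix (Fin n) (Fin k) ℂ} (hW : Wᴴ * W = 1) :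
    (Wᴴ * ((U * realDiagonal x * V)ᴴ * (U * realDiagonal x * V)) * W).det ≤
      ((∏ i : Fin k, x (Fin.castLE hk i) ^ 2 : ℝ) : ℂ) := by
  have h1 : Vᴴ * V = 1 := Matrix.mem_unitaryGroup_iff'.1 hV
  have hVW : (V * W)ᴴ * (V * W) = 1 := by
    rw [Matrix.conjTranspose_mul, Matrix.mul_assoc, ← Matrix.mul_assoc Vᴴ, h1, Matrix.one_mul, hW]
  have := det_compression_le hk (l := fun i => x i ^ 2) (fun i => pow_pos (hx0 i) 2)
    (fun i j hij => pow_le_pow_left₀ (hx0 j).le (hx hij) 2) hVW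
  rw [conjTranspose_svd_mul_self hU]
  rw [Matrix.conjTranspose_mul] at this
  simpa only [Matrix.mul_assoc] using this

/-- **Horn's inequality** for the products of the largest singular values of invertible matrices. -/
lemma prod_singularValues_mul_le {n : ℕ} {UA VA UD VD UB VB : Matrix (Fin n) (Fin n) ℂ}
    (hUA : UA ∈ Matrix.unitaryGroup (Fin n) ℂ) (hVA : VA ∈ Matrix.unitaryGroup (Fin n) ℂ)
    (hUD : UD ∈ Matrix.unitaryGroup (Fin n) ℂ) (hVD : VD ∈ Matrix.unitaryGroup (Fin n) ℂ)
    (hUB : UB ∈ Matrix.unitaryGroup (Fin n) ℂ) (hVB : VB ∈ Matrix.unitaryGroup (Fin n) ℂ)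
    {a d b : Fin n → ℝ} (ha0 : ∀ i, 0 < a i) (ha : Antitone a) (hd0 : ∀ i, 0 < d i)
    (hd : Antitone d) (hb0 : ∀ i, 0 < b i)
    (h : UA * realDiagonal a * VA * (UD * realDiagonal d * VD) = UB * realDiagonal b * VB)
    {k : ℕ} (hk : k ≤ n) :
    ∏ i : Fin k, b (Fin.castLE hk i) ≤
      ∏ i : Fin k, a (Fin.castLE hk i) * d (Fin.castLE hk i) := by
  -- The first `k` right singular vectors of the product: they compress its Gram matrix to `diag
  -- (b^2)`.
  set W : Matrix (Fin n) (Fin k) ℂ := VBᴴ.submatrix id (Fin.castLE hk)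
  have hVB1 : VB * VBᴴ = 1 := Matrix.mem_unitaryGroup_iff.1 hVB
  have hinj := Fin.castLE_injective hk
  have hWd : ∀ M : Matrix (Fin n) (Fin n) ℂ,
      Wᴴ * (VBᴴ * M * VB) * W = M.submatrix (Fin.castLE hk) (Fin.castLE hk) := fun M => by
    have : Wᴴ * (VBᴴ * M * VB) * W =
        (VB * (VBᴴ * M * VB) * VBᴴ).submatrix (Fin.castLE hk) (Fin.castLE hk) := by
      ext i j; simp [W, Matrix.mul_apply]
    rw [this]
    congr 1
    calc _ = (VB * VBᴴ) * M * (VB * VBᴴ) := by simp only [Matrix.mul_assoc]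
      _ = M := by rw [hVB1, Matrix.one_mul, Matrix.mul_one]
  have hW : Wᴴ * W = 1 := by
    have := hWd 1
    have hVB2 : VBᴴ * VB = 1 := Matrix.mem_unitaryGroup_iff'.1 hVB
    rwa [Matrix.mul_one, hVB2, Matrix.mul_one,
      Matrix.submatrix_one _ hinj] at this
  have hdetB : (Wᴴ * ((UB * realDiagonal b * VB)ᴴ * (UB * realDiagonal b * VB)) * W).det =
      ((∏ i : Fin k, b (Fin.castLE hk i) ^ 2 : ℝ) : ℂ) := by
    rw [conjTranspose_svd_mul_self hUB, hWd, realDiagonal, Matrix.submatrix_diagonal _ _ hinj,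
      Matrix.det_diagonal]
    push_cast
    rfl
  have hA := fun {Q : Matrix (Fin n) (Fin k) ℂ} (hQ : Qᴴ * Q = 1) =>
    det_gram_svd_mul_le hk hUA hVA ha0 ha hQ
  have hD := det_gram_svd_mul_le hk hUD hVD hd0 hd hW
  have hGpd : (Wᴴ * ((UD * realDiagonal d * VD)ᴴ * (UD * realDiagonal d * VD)) * W).PosDef := by
    rw [conjTranspose_svd_mul_self hUD]
    refine ((posDef_realDiagonal fun i => pow_pos (hd0 i) 2).conjTranspose_mul_mul_same
      (mulVec_injective_of_conjTranspose_mul_eq_one ?_)).conjTranspose_mul_mul_same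
      (mulVec_injective_of_conjTranspose_mul_eq_one hW)
    exact Matrix.mem_unitaryGroup_iff'.1 hVD
  rw [← h] at hdetB
  set A := UA * realDiagonal a * VA
  set D := UD * realDiagonal d * VD
  set G := Wᴴ * (Dᴴ * D) * W with hG
  obtain ⟨R, hR, hRG, hu⟩ := hGpd.exists_sqrt
  -- Polar normalization: `D W = Q R` with `Q` having orthonormal columns, so the Gram determinant
  -- of `A D` on `W` splits into that of `D` on `W` and that of `A` on `Q`.
  have hQ : (D * W * R⁻¹)ᴴ * (D * W * R⁻¹) = 1 := by
    rw [Matrix.conjTranspose_mul, Matrix.conjTranspose_mul, Matrix.conjTranspose_nonsing_inv, hR]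
    calc _ = R⁻¹ * G * R⁻¹ := by rw [hG]; simp only [Matrix.mul_assoc]
      _ = (R⁻¹ * R) * (R * R⁻¹) := by rw [← hRG]; simp only [Matrix.mul_assoc]
      _ = 1 := by rw [Matrix.nonsing_inv_mul _ hu, Matrix.mul_nonsing_inv _ hu, Matrix.one_mul]
  have hfac : Wᴴ * ((A * D)ᴴ * (A * D)) * W =
      R * ((D * W * R⁻¹)ᴴ * (Aᴴ * A) * (D * W * R⁻¹)) * R := by
    rw [Matrix.conjTranspose_mul (D * W), Matrix.conjTranspose_mul D W,
      Matrix.conjTranspose_nonsing_inv, hR, Matrix.conjTranspose_mul A]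
    calc _ = (R * R⁻¹) * (Wᴴ * ((Dᴴ * Aᴴ) * (A * D)) * W) * (R⁻¹ * R) := by
          rw [Matrix.nonsing_inv_mul _ hu, Matrix.mul_nonsing_inv _ hu, Matrix.one_mul,
            Matrix.mul_one]
      _ = _ := by simp only [Matrix.mul_assoc]
  have hdet : ((∏ i : Fin k, b (Fin.castLE hk i) ^ 2 : ℝ) : ℂ) =
      G.det * ((D * W * R⁻¹)ᴴ * (Aᴴ * A) * (D * W * R⁻¹)).det := by
    rw [← hdetB, hfac, Matrix.det_mul, Matrix.det_mul, ← hRG, Matrix.det_mul]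
    ring
  have hle : ((∏ i : Fin k, b (Fin.castLE hk i) ^ 2 : ℝ) : ℂ) ≤
      ((∏ i : Fin k, d (Fin.castLE hk i) ^ 2 : ℝ) : ℂ) *
        ((∏ i : Fin k, a (Fin.castLE hk i) ^ 2 : ℝ) : ℂ) := by
    rw [hdet]
    refine mul_le_mul hD (hA hQ) ?_ ?_
    · exact ((Matrix.posSemidef_conjTranspose_mul_self A).conjTranspose_mul_mul_same _).det_nonneg
    · exact_mod_cast Finset.prod_nonneg fun i _ => sq_nonneg _
  rw [← Complex.ofReal_mul] at hle
  have hle' := Complex.real_le_real.1 hle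
  rw [Finset.prod_pow, Finset.prod_pow, Finset.prod_pow, ← mul_pow] at hle'
  rw [Finset.prod_mul_distrib, mul_comm]
  exact (pow_le_pow_iff_left₀ (Finset.prod_nonneg fun i _ => (hb0 _).le)
    (mul_nonneg (Finset.prod_nonneg fun i _ => (hd0 _).le)
      (Finset.prod_nonneg fun i _ => (ha0 _).le)) two_ne_zero).1 hle'


/-! ### Majorization and Hölder's inequality. -/

/-- Abel summation, as an induction that subtracts the last weight from the others. -/
lemma sum_mul_nonneg_of_antitone_of_partial_sums_nonneg : ∀ {n : ℕ} {w x : Fin n → ℝ},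
    Antitone w → (∀ i, 0 ≤ w i) →
    (∀ k (hk : k ≤ n), 0 ≤ ∑ i : Fin k, x (Fin.castLE hk i)) → 0 ≤ ∑ i, w i * x i
  | 0, _, _, _, _, _ => by simp
  | n + 1, w, x, hw, hw0, hx => by
    have h1 : 0 ≤ ∑ i : Fin n, (w i.castSucc - w (Fin.last n)) * x i.castSucc :=
      sum_mul_nonneg_of_antitone_of_partial_sums_nonneg
        (fun i j hij => sub_le_sub_right (hw (Fin.castSucc_le_castSucc_iff.2 hij)) _)
        (fun i => sub_nonneg.2 (hw (Fin.le_last _)))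
        fun k hk => hx k (hk.trans n.le_succ)
    have h2 : 0 ≤ w (Fin.last n) * ∑ i, x i := mul_nonneg (hw0 _) (hx (n + 1) le_rfl)
    rw [Fin.sum_univ_castSucc] at h2 ⊢
    simp only [sub_mul, Finset.sum_sub_distrib, ← Finset.mul_sum] at h1
    linarith

/-- Weak log-majorization implies weak majorization of positive powers. -/
lemma sum_mul_rpow_le_of_prod_le {n : ℕ} {b t c : Fin n → ℝ} (hb0 : ∀ i, 0 < b i)
    (hb : Antitone b) (ht0 : ∀ i, 0 < t i) (hc0 : ∀ i, 0 ≤ c i) (hc : Antitone c)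
    (h : ∀ k (hk : k ≤ n), ∏ i : Fin k, b (Fin.castLE hk i) ≤ ∏ i : Fin k, t (Fin.castLE hk i))
    {β : ℝ} (hβ : 0 < β) : ∑ i, c i * b i ^ β ≤ ∑ i, c i * t i ^ β := by
  -- The weights `c b^β` decrease, and the partial sums of `log (t/b)` are nonnegative by `h`.
  have hw : 0 ≤ ∑ i, c i * b i ^ β * (Real.log (t i) - Real.log (b i)) := by
    refine sum_mul_nonneg_of_antitone_of_partial_sums_nonneg (fun i j hij => ?_)
      (fun i => mul_nonneg (hc0 i) (Real.rpow_nonneg (hb0 i).le _)) fun k hk => ?_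
    · exact mul_le_mul (hc hij) (Real.rpow_le_rpow (hb0 j).le (hb hij) hβ.le)
        (Real.rpow_nonneg (hb0 j).le _) (hc0 i)
    · rw [Finset.sum_sub_distrib, ← Real.log_prod fun i _ => (ht0 _).ne',
        ← Real.log_prod fun i _ => (hb0 _).ne', sub_nonneg]
      exact Real.log_le_log (Finset.prod_pos fun i _ => hb0 _) (h k hk)
  -- Tangent line bound `exp s ≥ 1 + s` at `s = β log (t/b)`.
  have hle : ∀ i, c i * b i ^ β + β * (c i * b i ^ β * (Real.log (t i) - Real.log (b i))) ≤
      c i * t i ^ β := fun i => by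
    have h1 := Real.add_one_le_exp (β * (Real.log (t i) - Real.log (b i)))
    have h2 : t i ^ β = b i ^ β * Real.exp (β * (Real.log (t i) - Real.log (b i))) := by
      rw [Real.rpow_def_of_pos (ht0 i), Real.rpow_def_of_pos (hb0 i), ← Real.exp_add]
      ring_nf
    rw [h2]
    have := mul_le_mul_of_nonneg_left h1
      (mul_nonneg (hc0 i) (Real.rpow_nonneg (hb0 i).le β))
    linarith
  have := Finset.sum_le_sum fun i (_ : i ∈ Finset.univ) => hle i
  rw [Finset.sum_add_distrib, ← Finset.mul_sum] at this
  linarith [mul_nonneg hβ.le hw]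

/-- Hölder with exponents `1/p` and `1/(1-p)`, the weight split as `c = c^p c^(1-p)`. -/
lemma sum_mul_rpow_mul_rpow_le {ι : Type*} [Fintype ι] {c u v : ι → ℝ} (hc : ∀ i, 0 ≤ c i)
    (hu : ∀ i, 0 ≤ u i) (hv : ∀ i, 0 ≤ v i) {p : ℝ} (hp0 : 0 < p) (hp1 : p < 1) :
    ∑ i, c i * (u i ^ p * v i ^ (1 - p)) ≤
      (∑ i, c i * u i) ^ p * (∑ i, c i * v i) ^ (1 - p) := by
  have hq : 0 < 1 - p := by linarith
  have hconj : (1 / p).HolderConjugate (1 / (1 - p)) := by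
    rw [Real.holderConjugate_iff]
    exact ⟨by rw [lt_div_iff₀ hp0]; linarith, by simp⟩
  have h := Real.inner_le_Lp_mul_Lq_of_nonneg Finset.univ hconj
    (f := fun i => (c i * u i) ^ p) (g := fun i => (c i * v i) ^ (1 - p))
    (fun i _ => Real.rpow_nonneg (mul_nonneg (hc i) (hu i)) _)
    (fun i _ => Real.rpow_nonneg (mul_nonneg (hc i) (hv i)) _)
  have e1 : ∀ i, ((c i * u i) ^ p) ^ (1 / p) = c i * u i := fun i => by
    rw [← Real.rpow_mul (mul_nonneg (hc i) (hu i)), mul_one_div_cancel hp0.ne', Real.rpow_one]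
  have e2 : ∀ i, ((c i * v i) ^ (1 - p)) ^ (1 / (1 - p)) = c i * v i := fun i => by
    rw [← Real.rpow_mul (mul_nonneg (hc i) (hv i)), mul_one_div_cancel hq.ne', Real.rpow_one]
  simp only [e1, e2, one_div_one_div] at h
  refine le_trans (le_of_eq (Finset.sum_congr rfl fun i _ => ?_)) h
  rw [Real.mul_rpow (hc i) (hu i), Real.mul_rpow (hc i) (hv i)]
  have : c i ^ p * c i ^ (1 - p) = c i := by
    rw [← Real.rpow_add_of_nonneg (hc i) hp0.le hq.le]
    simp
  calc _ = (c i ^ p * c i ^ (1 - p)) * (u i ^ p * v i ^ (1 - p)) := by rw [this]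
    _ = _ := by ring

/-- **Hölder's inequality** for unitarily invariant norms, for the factorization `A = B C` with
the factor `C` moved to the other side. -/
lemma IsUnitarilyInvariantNorm.map_matrixAbsPow_le {n : ℕ}
    {N : Seminorm ℂ (Matrix (Fin n) (Fin n) ℂ)} (hN : IsUnitarilyInvariantNorm N)
    {A B C : Matrix (Fin n) (Fin n) ℂ} (hA : IsUnit A) (hABC : A = B * C)
    {α p r : ℝ} (hα : 0 < α) (hp0 : 0 < p) (hp1 : p < 1) (hr : r = p / (1 - p)) :
    N (matrixAbsPow B (α * p)) ≤
      N (matrixAbsPow A α) ^ p * N (matrixAbsPow C (-(α * r))) ^ (1 - p) := by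
  have hq : 0 < 1 - p := by linarith
  have hdet : IsUnit (B.det * C.det) := by
    rw [← Matrix.det_mul, ← hABC]; exact (Matrix.isUnit_iff_isUnit_det _).1 hA
  have hBu := isUnit_of_mul_isUnit_left hdet
  have hCu := isUnit_of_mul_isUnit_right hdet
  obtain ⟨UA, hUA, VA, hVA, a, ha0, ha, eA⟩ := exists_svd hA
  obtain ⟨UB, hUB, VB, hVB, b, hb0, hb, eB⟩ := exists_svd ((Matrix.isUnit_iff_isUnit_det _).2 hBu)
  obtain ⟨UD, hUD, VD, hVD, d, hd0, hd, eD⟩ :=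
    exists_svd ((Matrix.isUnit_iff_isUnit_det _).2 (Matrix.isUnit_nonsing_inv_det _ hCu))
  have eB' : A * C⁻¹ = B := by rw [hABC, Matrix.mul_nonsing_inv_cancel_right _ _ hCu]
  have eC : C = VDᴴ * realDiagonal (fun i => (d i)⁻¹) * UDᴴ := by
    have hUD1 : UDᴴ * UD = 1 := Matrix.mem_unitaryGroup_iff'.1 hUD
    have hVD1 : VDᴴ * VD = 1 := Matrix.mem_unitaryGroup_iff'.1 hVD
    have : VDᴴ * realDiagonal (fun i => (d i)⁻¹) * UDᴴ * C⁻¹ = 1 := by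
      rw [eD]
      calc _ = VDᴴ * (realDiagonal (fun i => (d i)⁻¹) * (UDᴴ * UD) * realDiagonal d) * VD := by
            simp only [Matrix.mul_assoc]
        _ = 1 := by
            rw [hUD1, Matrix.mul_one, realDiagonal_mul,
              realDiagonal_eq_one fun i => inv_mul_cancel₀ (hd0 i).ne', Matrix.mul_one, hVD1]
    calc C = VDᴴ * realDiagonal (fun i => (d i)⁻¹) * UDᴴ * C⁻¹ * C := by
          rw [this, Matrix.one_mul]
      _ = _ := Matrix.nonsing_inv_mul_cancel_right _ _ hCu
  have hhorn := fun k (hk : k ≤ n) => prod_singularValues_mul_le hUA hVA hUD hVD hUB hVB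
    ha0 ha hd0 hd hb0 (by rw [← eA, ← eD, ← eB, eB']) hk
  have nA : N (matrixAbsPow A α) = N (realDiagonal fun i => a i ^ α) := by
    rw [eA, hN.map_matrixAbsPow hUA hVA ha0]
  have nB : N (matrixAbsPow B (α * p)) = N (realDiagonal fun i => b i ^ (α * p)) := by
    rw [eB, hN.map_matrixAbsPow hUB hVB hb0]
  have nC : N (matrixAbsPow C (-(α * r))) = N (realDiagonal fun i => d i ^ (α * r)) := by
    have hUD' : UDᴴ ∈ Matrix.unitaryGroup (Fin n) ℂ := Unitary.star_mem hUD
    have hVD' : VDᴴ ∈ Matrix.unitaryGroup (Fin n) ℂ := Unitary.star_mem hVD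
    rw [eC, hN.map_matrixAbsPow hVD' hUD' fun i => inv_pos.2 (hd0 i)]
    simp only [Real.rpow_neg (inv_pos.2 (hd0 _)).le, Real.inv_rpow (hd0 _).le, inv_inv]
  have hαp : 0 < α * p := mul_pos hα hp0
  obtain ⟨c, hc0, hc, hcx, hcy⟩ := hN.exists_antitone_dual (x := fun i => b i ^ (α * p))
    (fun i => Real.rpow_nonneg (hb0 i).le _)
    fun i j hij => Real.rpow_le_rpow (hb0 j).le (hb hij) hαp.le
  rw [nA, nB, nC]
  calc _ ≤ ∑ i, c i * b i ^ (α * p) := hcx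
    _ ≤ ∑ i, c i * (a i * d i) ^ (α * p) :=
      sum_mul_rpow_le_of_prod_le hb0 hb (fun i => mul_pos (ha0 i) (hd0 i)) hc0 hc hhorn hαp
    -- Here `αp = αr(1-p)`.
    _ = ∑ i, c i * ((a i ^ α) ^ p * (d i ^ (α * r)) ^ (1 - p)) := by
      refine Finset.sum_congr rfl fun i _ => ?_
      rw [Real.mul_rpow (ha0 i).le (hd0 i).le, ← Real.rpow_mul (ha0 i).le,
        ← Real.rpow_mul (hd0 i).le, hr, mul_assoc α (p / (1 - p)), div_mul_cancel₀ _ hq.ne']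
    _ ≤ (∑ i, c i * a i ^ α) ^ p * (∑ i, c i * d i ^ (α * r)) ^ (1 - p) :=
      sum_mul_rpow_mul_rpow_le hc0 (fun i => Real.rpow_nonneg (ha0 i).le _)
        (fun i => Real.rpow_nonneg (hd0 i).le _) hp0 hp1
    _ ≤ _ := by
      have h1 : 0 ≤ ∑ i, c i * a i ^ α :=
        Finset.sum_nonneg fun i _ => mul_nonneg (hc0 i) (Real.rpow_nonneg (ha0 i).le _)
      have h2 : 0 ≤ ∑ i, c i * d i ^ (α * r) :=
        Finset.sum_nonneg fun i _ => mul_nonneg (hc0 i) (Real.rpow_nonneg (hd0 i).le _)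
      exact mul_le_mul (Real.rpow_le_rpow h1 (hcy _) hp0.le)
        (Real.rpow_le_rpow h2 (hcy _) hq.le) (Real.rpow_nonneg h2 _)
        (Real.rpow_nonneg (apply_nonneg N _) _)

/-- The factorization `A = U |A|^(1/p) · |A|^(1 - 1/p)` attains equality. -/
lemma IsUnitarilyInvariantNorm.exists_factorization {n : ℕ}
    {N : Seminorm ℂ (Matrix (Fin n) (Fin n) ℂ)} (hN : IsUnitarilyInvariantNorm N)
    {A : Matrix (Fin n) (Fin n) ℂ} (hA : IsUnit A) {α p r : ℝ} (hp0 : 0 < p) (hp1 : p < 1)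
    (hr : r = p / (1 - p)) :
    ∃ B C : Matrix (Fin n) (Fin n) ℂ, A = B * C ∧
      N (matrixAbsPow B (α * p)) = N (matrixAbsPow A α) ∧
      N (matrixAbsPow C (-(α * r))) = N (matrixAbsPow A α) := by
  have hq : 0 < 1 - p := by linarith
  have hr0 : 0 < r := hr ▸ div_pos hp0 hq
  have hpr : 1 / p + -(1 / r) = 1 := by rw [hr]; field_simp; ring
  obtain ⟨U, hU, V, hV, a, ha0, ha, eA⟩ := exists_svd hA
  have nB := hN.map_matrixAbsPow hU (one_mem _)
    (fun i => Real.rpow_pos_of_pos (ha0 i) (1 / p)) (α * p)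
  have nC := hN.map_matrixAbsPow (one_mem _) hV
    (fun i => Real.rpow_pos_of_pos (ha0 i) (-(1 / r))) (-(α * r))
  have nA := hN.map_matrixAbsPow hU hV ha0 α
  rw [← eA] at nA
  have e1 : 1 / p * (α * p) = α := by field_simp
  have e2 : -(1 / r) * -(α * r) = α := by field_simp
  simp only [← Real.rpow_mul (ha0 _).le, e1] at nB
  simp only [← Real.rpow_mul (ha0 _).le, e2] at nC
  -- Unification with `nB` and `nC` yields `B = U diag(a^(1/p))` and `C = diag(a^(-1/r)) V`, up to
  -- factors `1`.
  refine ⟨_, _, ?_, nB.trans nA.symm, nC.trans nA.symm⟩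
  rw [Matrix.mul_one, Matrix.one_mul, Matrix.mul_assoc, ← Matrix.mul_assoc (realDiagonal _),
    realDiagonal_mul, ← Matrix.mul_assoc]
  simp only [← Real.rpow_add (ha0 _), hpr, Real.rpow_one]
  exact eA

theorem proposition3 {n : ℕ} (A : Matrix (Fin n) (Fin n) ℂ) (hA : IsUnit A)
    (α p r : ℝ) (hα : 0 < α) (hp0 : 0 < p) (hp1 : p < 1) (hr : r = -p / (p - 1))
    (N : Seminorm ℂ (Matrix (Fin n) (Fin n) ℂ)) (hN : IsUnitarilyInvariantNorm N) :
    IsGreatest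
        {x : ℝ | ∃ B C : Matrix (Fin n) (Fin n) ℂ, A = B * C ∧
          x = N (matrixAbsPow B (α * p)) ^ (1 / p) *
            N (matrixAbsPow C (-(α * r))) ^ (-(1 / r))}
        (N (matrixAbsPow A α)) ∧
      IsGreatest
        {x : ℝ | ∃ B C : Matrix (Fin n) (Fin n) ℂ, A = B * C ∧
          x = 1 / p * N (matrixAbsPow B (α * p)) -
            1 / r * N (matrixAbsPow C (-(α * r)))}
        (N (matrixAbsPow A α)) := by
  have hq : 0 < 1 - p := by linarith
  have hr' : r = p / (1 - p) := by rw [hr, ← neg_sub 1 p, neg_div_neg_eq]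
  have hr0 : 0 < r := hr' ▸ div_pos hp0 hq
  have hrp : 1 / r = (1 - p) * (1 / p) := by rw [hr']; field_simp
  have hpr : 1 / p + -(1 / r) = 1 := by rw [hrp]; field_simp; ring
  obtain ⟨B₀, C₀, h₀, hB₀, hC₀⟩ := hN.exists_factorization hA (α := α) hp0 hp1 hr'
  have hle := fun (B C : Matrix (Fin n) (Fin n) ℂ) (h : A = B * C) =>
    hN.map_matrixAbsPow_le hA h hα hp0 hp1 hr'
  have hZ := apply_nonneg N (matrixAbsPow A α)
  refine ⟨⟨⟨B₀, C₀, h₀, ?_⟩, ?_⟩, ⟨B₀, C₀, h₀, ?_⟩, ?_⟩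
  · rw [hB₀, hC₀, ← Real.rpow_add' hZ (by rw [hpr]; exact one_ne_zero), hpr, Real.rpow_one]
  · rintro _ ⟨B, C, h, rfl⟩
    have hx := apply_nonneg N (matrixAbsPow B (α * p))
    have hle := hle B C h
    -- If this norm vanishes, the convention `0 ^ (-(1/r)) = 0` makes the product zero.
    rcases (apply_nonneg N (matrixAbsPow C (-(α * r)))).eq_or_lt with hy | hy
    · rw [← hy, Real.zero_rpow (neg_ne_zero.2 (one_div_pos.2 hr0).ne'), mul_zero]
      exact hZ
    · have h1 := Real.rpow_le_rpow hx hle (one_div_pos.2 hp0).le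
      rw [Real.mul_rpow (Real.rpow_nonneg hZ _) (Real.rpow_nonneg hy.le _), ← Real.rpow_mul hZ,
        ← Real.rpow_mul hy.le, ← hrp, mul_one_div_cancel hp0.ne', Real.rpow_one] at h1
      rw [Real.rpow_neg hy.le, ← div_eq_mul_inv, div_le_iff₀ (Real.rpow_pos_of_pos hy _)]
      exact h1
  · rw [hB₀, hC₀, ← sub_mul, sub_eq_add_neg, hpr, one_mul]
  · rintro _ ⟨B, C, h, rfl⟩
    -- AM-GM with weights `p` and `1 - p`; dividing by `p` turns the latter into `1/r`.
    have h1 := (hle B C h).trans (Real.geom_mean_le_arith_mean2_weighted hp0.le hq.le hZ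
      (apply_nonneg N (matrixAbsPow C (-(α * r)))) (by ring))
    have h2 := mul_le_mul_of_nonneg_left h1 (one_div_pos.2 hp0).le
    rw [mul_add, ← mul_assoc, one_div_mul_cancel hp0.ne', one_mul, ← mul_assoc,
      mul_comm (1 / p) (1 - p), ← hrp] at h2
    linarith
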